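/- Definitions. A $T\times K$ complex orthogonal design (COD) in $k$ complex variables is a $T\times K$ matrix $\mathbf X$ with entries from $\{0,\pm x_i,\pm x_i^*\}$ such that $\mathbf X^H\mathbf X=(|x_1|^2+\dots+|x_k|^2)\mathbf I_K$; its rate is $k/T$, and it is a maximal-rate COD if no COD with $K$ columns (and any number of rows and variables) has a larger rate. Replacing the zeros of $\mathbf X$ by a constant $\alpha\neq 0$ gives the training-embedded design (TE-COD) of $\mathbf X$. A training-embedded distributed space-time block code (TE-DSTBC) for $K$ relays, with $k\le T$ complex information symbols $x_1,\dots,x_k$, is given by a training symbol $\alpha\ne0$, a complex signal set and relay matrices $\mathbf A_\lambda,\mathbf B_\lambda\in\mathbb C^{T\times T}$, $1\le\lambda\le K$. In the first phase the source broadcasts $[\alpha\cdots\alpha\;x_1\cdots x_k]^T$ with $\lceil\frac{T-k}2\rceil$ copies of $\alpha$, one entry per channel use; in the second phase, of $T$ channel uses, the relays generate the $T\times K$ codeword whose $\lambda$-th column is $\mathbf A_\lambda\bar{\mathbf x}+\mathbf B_\lambda\bar{\mathbf x}^*$, where $\bar{\mathbf x}=[\alpha\cdots\alpha\;x_1\cdots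 x_k]^T$ contains $T-k$ copies of $\alpha$. Its overall rate is $k$ divided by the total number of channel uses of both phases. It is generated by a COD $\mathbf X$ if its codeword equals the TE-COD of $\mathbf X$ for all values of $x_1,\dots,x_k$. Statement. (1) The overall rate of a TE-DSTBC is $$\frac{k}{\lceil\frac{T-k}{2}\rceil+k+T}.$$ (2) Every COD with $K\ge1$ columns generates, for every $\alpha\ne0$ and every signal set, a TE-DSTBC; and maximal-rate CODs exist for every $K\ge 1$. (3) Let $m\ge1$ and $K\in\{2m,2m-1\}$. A TE-DSTBC generated by a maximal-rate COD with $K$ columns and $T$ rows has overall rate $$\frac{\frac{T(m+1)}{2m}}{\frac{T(m+1)}{2m}+T+\left\lceil T\left(\frac14-\frac1{4m}\right)\right\rceil}.$$ (4) There are maximal-rate CODs with $(K,T,k)=(4,4,3)$, $(5,15,10)$, $(6,30,20)$, $(7,56,35)$, $(8,112,70)$, $(9,210,126)$, $(10,420,252)$, and the TE-DSTBCs generated by maximal-rate CODs with these parameters have the overall rates $$\frac38,\quad\frac5{14},\quad\frac4{11},\quad\frac{35}{102},\quad\frac{70}{203},\quad\frac{126}{378}=\frac13,\quad\frac{252}{756}=\frac13,$$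 respectively. (5) The earlier single-symbol decodable DSTBCs, of rate $k/T=\frac12$ in the second phase, have overall rate $k/(k+T)=\frac13$ if the first phase is counted with $k$ channel uses, that is, without training. For every $K\ge1$, a TE-DSTBC generated by a maximal-rate COD with $K$ columns has overall rate greater than $\frac13$ if and only if $K<9$, equal to $\frac13$ if and only if $K\in\{9,10\}$, and smaller than $\frac13$ if and only if $K\ge11$. -/

import Mathlib

open scoped Matrix

namespace TECOD

/-! ### Complex orthogonal designs -/

/-- An entry of a complex design in the variables `x₁, …, x_k`: either `0`, or one of
`x_i`, `-x_i`, `x_i^*`, `-x_i^*`. -/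
inductive Entry (k : ℕ) : Type
  | zero : Entry k
  | var (sign : ℤˣ) (i : Fin k) : Entry k
  | conjVar (sign : ℤˣ) (i : Fin k) : Entry k

/-- The value of an entry when the variables take the values `x` and the zero entry is
replaced by the constant `α` (so `α = 0` gives the value of the entry itself). -/
noncomputable def Entry.eval {k : ℕ} (α : ℂ) (x : Fin k → ℂ) : Entry k → ℂ
  | .zero => α
  | .var s i => ((s : ℤ) : ℂ) * x i
  | .conjVar s i => ((s : ℤ) : ℂ) * star (x i)

/-- A `T × K` complex design in `k` variables, as a matrix of formal entries. -/
abbrev Design (T K k : ℕ) : Type := Matrix (Fin T) (Fin K) (Entry k)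

/-- The complex matrix obtained from a design by inserting values for the variables. -/
noncomputable def Design.eval {T K k : ℕ} (X : Design T K k) (x : Fin k → ℂ) :
    Matrix (Fin T) (Fin K) ℂ :=
  X.map (Entry.eval 0 x)

/-- The training-embedded version of a design: all zeros are replaced by the constant `α`. -/
noncomputable def Design.teEval {T K k : ℕ} (X : Design T K k) (α : ℂ) (x : Fin k → ℂ) :
    Matrix (Fin T) (Fin K) ℂ :=
  X.map (Entry.eval α x)

/-- `X` is a complex orthogonal design (COD): `Xᴴ X = (|x₁|² + ⋯ + |x_k|²) I_K`. -/
def Design.IsCOD {T K k : ℕ} (X : Design T K k) : Prop :=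
  ∀ x : Fin k → ℂ, (X.eval x)ᴴ * X.eval x =
    ((∑ i, ‖x i‖ ^ 2 : ℝ) : ℂ) • (1 : Matrix (Fin K) (Fin K) ℂ)

/-- `X` is a COD whose rate `k / T` is the largest one among all CODs with the same number `K`
of columns (and any numbers of rows and variables). -/
def Design.IsMaximalRateCOD {T K k : ℕ} (X : Design T K k) : Prop :=
  X.IsCOD ∧ ∀ (T' k' : ℕ) (Y : Design T' K k'), Y.IsCOD → (k' : ℚ) / T' ≤ (k : ℚ) / T

/-! ### Training-embedded distributed space-time block codes -/

/-- The number `N = ⌈(T - k) / 2⌉ + k` of channel uses in the first phase: `⌈(T - k) / 2⌉`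
training symbols followed by the `k` information symbols. -/
def firstPhaseUses (T k : ℕ) : ℕ := ⌈((T : ℚ) - k) / 2⌉₊ + k

/-- The data determining a training-embedded distributed space-time block code for `K` relays,
with `k` information symbols and `T` channel uses in the second phase: the nonzero training
symbol `α`, the complex signal set, and the relay matrices `A_λ`, `B_λ`. -/
structure TEDSTBC (T K k : ℕ) where
  k_le : k ≤ T
  alpha : ℂ
  alpha_ne_zero : alpha ≠ 0
  signalSet : Set ℂ
  A : Fin K → Matrix (Fin T) (Fin T) ℂ
  B : Fin K → Matrix (Fin T) (Fin T) ℂ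

namespace TEDSTBC

variable {T K k : ℕ}

/-- The vector `[α ⋯ α x₁ ⋯ x_k]` of length `N` broadcast by the source in the first phase. -/
def sourceVector (C : TEDSTBC T K k) (x : Fin k → ℂ) : Fin (firstPhaseUses T k) → ℂ :=
  Fin.append (fun _ => C.alpha) x

/-- The codebook of the source: all source vectors with symbols from the signal set. -/
def sourceCodebook (C : TEDSTBC T K k) : Set (Fin (firstPhaseUses T k) → ℂ) :=
  C.sourceVector '' {x | ∀ i, x i ∈ C.signalSet}

/-- The vector `x̄ = [α ⋯ α x₁ ⋯ x_k]` of length `T`, with `T - k` copies of `α`. -/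
def extendedVector (C : TEDSTBC T K k) (x : Fin k → ℂ) : Fin T → ℂ := fun t =>
  Fin.append (fun _ : Fin (T - k) => C.alpha) x (t.cast (Nat.sub_add_cancel C.k_le).symm)

/-- The `T × K` codeword, whose `λ`-th column is `A_λ x̄ + B_λ x̄^*`; its rows correspond to the
channel uses of the second phase, its columns to the relays. -/
noncomputable def codeword (C : TEDSTBC T K k) (x : Fin k → ℂ) : Matrix (Fin T) (Fin K) ℂ :=
  Matrix.of fun t l =>
    (C.A l *ᵥ C.extendedVector x + C.B l *ᵥ star (C.extendedVector x)) t

/-- The collection of codewords. -/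
def code (C : TEDSTBC T K k) : Set (Matrix (Fin T) (Fin K) ℂ) :=
  C.codeword '' {x | ∀ i, x i ∈ C.signalSet}

/-- The number of channel uses in the first phase (the length of the source vectors) plus the
number of channel uses in the second phase (the number of rows of the codewords). -/
def channelUses (_C : TEDSTBC T K k) : ℕ :=
  Fintype.card (Fin (firstPhaseUses T k)) + Fintype.card (Fin T)

/-- The overall rate, in complex information symbols per channel use, both phases counted. -/
def overallRate (C : TEDSTBC T K k) : ℚ := (k : ℚ) / C.channelUses

/-- The code consists of the values of the TE-COD obtained from the design `X`, that is, its
relay matrices are column-vector representation matrices of that TE-COD. -/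
def IsGeneratedBy (C : TEDSTBC T K k) (X : Design T K k) : Prop :=
  ∀ x : Fin k → ℂ, C.codeword x = X.teEval C.alpha x

end TEDSTBC

/-- The overall rate of a two-phase scheme whose training is not counted: `k` symbols are sent
in `k` channel uses of the first phase and `T` channel uses of the second phase. -/
def overallRateWithoutTraining (T k : ℕ) : ℚ := (k : ℚ) / ((k : ℚ) + T)

/-- There is a maximal-rate COD for `K` relays with `T` rows and `k` variables, and every TE-DSTBC
generated by such a COD has overall rate `r`. -/
def TableEntry (K T k : ℕ) (r : ℚ) : Prop :=
  (∃ X : Design T K k, X.IsMaximalRateCOD) ∧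
    ∀ (X : Design T K k) (C : TEDSTBC T K k),
      X.IsMaximalRateCOD → C.IsGeneratedBy X → C.overallRate = r

end TECOD

/-!
A complex orthogonal design with `K = 2m` or `K = 2m - 1` columns has rate at most
`(m + 1) / (2m)`. Each variable `x_i` occurs exactly once in every column. In the row in which it
occurs in the column `a`, the other nonzero entries lie in columns in which `x_i` occurs with the
opposite conjugation status. If `x_i` is conjugated in `p` columns and not in `q = K - p` columns,
then the weights of the `K` rows containing `x_i` add up to at most `K + 2pq`. This bounds the sum
of the squared row weights `w` from above, and `(w - m) (w - m - 1) ≥ 0` bounds it from below.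

The bound is attained by the design with the subsets of `{1, …, K}` of cardinality `m - 1` or
`m + 1` as rows, the subsets of cardinality `m` as variables, and the entries `± x_{S ∆ {j}}`,
conjugated if `j ∈ S`. Its columns are orthogonal by the anticommutation relations of creation and
annihilation operators.

Up to the rounding, the overall rate exceeds `1/3` if and only if `5k > 3T`, that is, `m < 5`. For
`m < 5` the rounding matters only for two very short designs. `(T, k) = (3, 2)` has fewer rows than
columns. `(T, k) = (8, 5)` with seven columns would require two rows of weight `5`, but these have a
common nonzero column, which forces their weights to add up to at most `9`.
-/

namespace TECOD

open Finset

theorem eq_zero_and_eq_zero_of_forall_mul_star_add_mul {c d : ℂ}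
    (h : ∀ z : ℂ, c * star z + d * z = 0) : c = 0 ∧ d = 0 := by
  have hone : c + d = 0 := by simpa using h 1
  have hI : -c * Complex.I + d * Complex.I = 0 := by simpa using h Complex.I
  have hdc : -c + d = 0 := (mul_eq_zero.1 (by rw [add_mul, hI])).resolve_right Complex.I_ne_zero
  constructor
  · linear_combination (hone - hdc) / 2
  · linear_combination (hone + hdc) / 2

theorem sum_card_filter_ne {α : Type*} [Fintype α] (c : α → Bool) :
    ∑ a, #{b | c b ≠ c a} = 2 * (#{b | c b = true} * #{b | c b = false}) := by
  have hterm (a : α) : #{b | c b ≠ c a} =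
      (if c a = true then #{b | c b = false} else 0) +
        if c a = false then #{b | c b = true} else 0 := by
    cases c a <;> simp
  simp only [hterm, sum_add_distrib, ← sum_filter, sum_const, smul_eq_mul]
  ring

theorem mul_add_sq_le_mul_add {p q m : ℕ} (h : p + q = 2 * m ∨ p + q + 1 = 2 * m) :
    p * q + m ^ 2 ≤ m * (p + q) := by
  wlog hpq : p ≤ q generalizing p q
  · rw [mul_comm p, add_comm p]
    exact this (by omega) (le_of_not_ge hpq)
  obtain ⟨u, rfl⟩ := Nat.exists_eq_add_of_le (show p ≤ m by omega)
  obtain ⟨v, rfl⟩ := Nat.exists_eq_add_of_le (show p + u ≤ q by omega)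
  nlinarith

theorem two_mul_add_one_mul_le (w m : ℕ) : (2 * m + 1) * w ≤ w * w + m * (m + 1) := by
  rcases le_or_gt w m with h | h
  · obtain ⟨u, rfl⟩ := Nat.exists_eq_add_of_le h
    nlinarith
  · obtain ⟨u, rfl⟩ := Nat.exists_eq_add_of_lt h
    nlinarith

/-! ### Occurrences of the variables in an orthogonal design -/

namespace Entry

variable {k : ℕ} {e : Entry k} {i : Fin k}

/-- The index of the variable occurring in an entry; `none` for the entry `0`. -/
def index : Entry k → Option (Fin k)
  | .zero => none
  | .var _ i => some i
  | .conjVar _ i => some i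

/-- Whether an entry is a conjugated variable `±x_i^*`. -/
def isConj : Entry k → Bool
  | .conjVar _ _ => true
  | _ => false

theorem exists_eval_eq (h : e.index = some i) :
    ∃ s : ℤˣ, ∀ (α : ℂ) (x : Fin k → ℂ),
      e.eval α x = ((s : ℤ) : ℂ) * if e.isConj then star (x i) else x i := by
  cases e with
  | zero => simp [index] at h
  | var s j =>
    obtain rfl : j = i := by simpa [index] using h
    exact ⟨s, fun _ _ => rfl⟩
  | conjVar s j =>
    obtain rfl : j = i := by simpa [index] using h
    exact ⟨s, fun _ _ => rfl⟩

theorem eval_congr {α : ℂ} {x y : Fin k → ℂ} (h : ∀ i, e.index = some i → x i = y i) :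
    e.eval α x = e.eval α y := by
  cases e <;> simp_all [eval, index]

theorem eval_eq_zero {x : Fin k → ℂ} (h : ∀ i, e.index = some i → x i = 0) : e.eval 0 x = 0 := by
  cases e <;> simp_all [eval, index]

theorem eval_ne_zero {α : ℂ} {x : Fin k → ℂ} (h : e.index = some i) (hx : x i ≠ 0) :
    e.eval α x ≠ 0 := by
  obtain ⟨s, hs⟩ := exists_eval_eq h
  rw [hs]
  refine mul_ne_zero (Int.cast_ne_zero.2 s.ne_zero) ?_
  split_ifs
  · exact star_ne_zero.2 hx
  · exact hx

theorem star_eval_single_mul_self (e : Entry k) (i : Fin k) :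
    star (e.eval 0 (Pi.single i 1)) * e.eval 0 (Pi.single i 1) =
      if e.index = some i then 1 else 0 := by
  split_ifs with h
  · obtain ⟨s, hs⟩ := exists_eval_eq h
    rcases Int.units_eq_one_or s with rfl | rfl <;> simp [hs]
  · rw [eval_eq_zero, mul_zero]
    exact fun j hj => Pi.single_eq_of_ne (fun hji : j = i => h (hji ▸ hj)) _

end Entry

namespace Design

variable {T K k : ℕ} {X : Design T K k} {r s t : Fin T} {a b : Fin K} {i j : Fin k}

theorem isCOD_iff_sum : X.IsCOD ↔ ∀ (x : Fin k → ℂ) (a b : Fin K),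
    ∑ t, star ((X t a).eval 0 x) * (X t b).eval 0 x =
      if a = b then ((∑ i, ‖x i‖ ^ 2 : ℝ) : ℂ) else 0 := by
  refine forall_congr' fun x => ?_
  rw [← Matrix.ext_iff]
  refine forall₂_congr fun a b => ?_
  simp [Matrix.mul_apply, Design.eval, Matrix.one_apply]

theorem IsCOD.submatrix (h : X.IsCOD) {K' : ℕ} {f : Fin K' → Fin K} (hf : Function.Injective f) :
    Design.IsCOD (Matrix.submatrix X id f : Design T K' k) := by
  rw [isCOD_iff_sum] at h ⊢
  intro x a b
  simpa [hf.eq_iff] using h x (f a) (f b)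

theorem IsCOD.existsUnique_row (h : X.IsCOD) (i : Fin k) (a : Fin K) :
    ∃! t, (X t a).index = some i := by
  have hnorm : ∑ j, ‖(Pi.single i 1 : Fin k → ℂ) j‖ ^ 2 = 1 := by
    simp [Pi.single_apply, apply_ite norm, ite_pow]
  have hsum := isCOD_iff_sum.1 h (Pi.single i 1) a a
  simp only [Entry.star_eval_single_mul_self, if_true, sum_boole, hnorm] at hsum
  have hcard : #{t | (X t a).index = some i} = 1 := by exact_mod_cast hsum
  simpa [Finset.singleton_iff_unique_mem] using card_eq_one.1 hcard

theorem IsCOD.row_unique (h : X.IsCOD) (hr : (X r a).index = some i)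
    (hs : (X s a).index = some i) : r = s :=
  (h.existsUnique_row i a).unique hr hs

theorem IsCOD.col_unique (h : X.IsCOD) (ha : (X t a).index = some i)
    (hb : (X t b).index = some i) : a = b := by
  by_contra hab
  have hsum := isCOD_iff_sum.1 h (Pi.single i 1) a b
  rw [if_neg hab, sum_eq_single_of_mem t (mem_univ t)] at hsum
  · exact mul_ne_zero (star_ne_zero.2 (Entry.eval_ne_zero ha (by simp)))
      (Entry.eval_ne_zero hb (by simp)) hsum
  · intro s _ hs
    rw [Entry.eval_eq_zero (e := X s a), star_zero, zero_mul]
    exact fun j hj => Pi.single_eq_of_ne (fun hji => hs (h.row_unique (hji ▸ hj) ha)) _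

theorem IsCOD.sum_pair_eq_zero (h : X.IsCOD) (hab : a ≠ b) (hr : (X r a).index = some i)
    (hs : (X s b).index = some i) {x : Fin k → ℂ} (hx : ∀ l, l ≠ i → l ≠ j → x l = 0) :
    star ((X r a).eval 0 x) * (X r b).eval 0 x +
      star ((X s a).eval 0 x) * (X s b).eval 0 x = 0 := by
  have hrs : r ≠ s := fun hrs => hab (h.col_unique hr (hrs ▸ hs))
  have hsum := isCOD_iff_sum.1 h x a b
  rw [if_neg hab] at hsum
  rw [← sum_pair hrs (f := fun t => star ((X t a).eval 0 x) * (X t b).eval 0 x)]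
  refine (sum_subset (subset_univ _) fun t _ ht => ?_).trans hsum
  obtain ⟨htr, hts⟩ : t ≠ r ∧ t ≠ s := by simpa using ht
  by_cases haj : (X t a).index = some j
  · rw [Entry.eval_eq_zero (e := X t b), mul_zero]
    exact fun l hl => hx l (fun hli => hts (h.row_unique (hli ▸ hl) hs))
      fun hlj => hab (h.col_unique haj (hlj ▸ hl))
  · rw [Entry.eval_eq_zero (e := X t a), star_zero, zero_mul]
    exact fun l hl => hx l (fun hli => htr (h.row_unique (hli ▸ hl) hr))
      fun hlj => haj (hlj ▸ hl)

/-- Take `x_i = z` and `x_j = 1`, where `x_j` is the variable in position `(r, b)`. The inner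
product of the columns `a` and `b` then reduces to the rows `r` and `s`. If `x_i` has the same
conjugation status in both, one row contributes a nonzero multiple of `z` and the other a multiple
of `z^*`, and these cannot cancel for all `z`. -/
theorem IsCOD.index_eq_none_of_isConj_eq (h : X.IsCOD) (hab : a ≠ b)
    (hr : (X r a).index = some i) (hs : (X s b).index = some i)
    (hconj : (X r a).isConj = (X s b).isConj) : (X r b).index = none := by
  rw [Option.eq_none_iff_forall_ne_some]
  intro j hj
  have hji : j ≠ i := fun hji => hab (h.col_unique hr (hji ▸ hj))
  let x (z : ℂ) : Fin k → ℂ := Function.update (Pi.single j 1) i z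
  have hxi (z : ℂ) : x z i = z := Function.update_self ..
  have hxj (z : ℂ) : x z j = 1 := by simp [x, hji]
  have hsa (z : ℂ) : (X s a).eval 0 (x z) = (X s a).eval 0 (x 0) := by
    refine Entry.eval_congr fun l hl => ?_
    have hli : l ≠ i := fun hli => hab (h.col_unique (hli ▸ hl) hs)
    simp [x, hli]
  have hsum (z : ℂ) := h.sum_pair_eq_zero hab hr hs (x := x z) (j := j)
    fun l hli hlj => by simp [x, hli, hlj]
  obtain ⟨u, hu⟩ := Entry.exists_eval_eq hr
  obtain ⟨v, hv⟩ := Entry.exists_eval_eq hj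
  obtain ⟨w, hw⟩ := Entry.exists_eval_eq hs
  have huv : ((u : ℤ) : ℂ) * ((v : ℤ) : ℂ) ≠ 0 :=
    mul_ne_zero (Int.cast_ne_zero.2 u.ne_zero) (Int.cast_ne_zero.2 v.ne_zero)
  simp only [hsa, hu, hv, hw, ← hconj, hxi, hxj, star_one, ite_self, mul_one] at hsum
  cases hc : (X r a).isConj <;> simp only [hc, if_true, if_false, Bool.false_eq_true, star_mul',
    star_intCast, star_star] at hsum
  · refine huv (eq_zero_and_eq_zero_of_forall_mul_star_add_mul
      (d := star ((X s a).eval 0 (x 0)) * ((w : ℤ) : ℂ)) fun z => ?_).1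
    linear_combination hsum z
  · refine huv (eq_zero_and_eq_zero_of_forall_mul_star_add_mul
      (c := star ((X s a).eval 0 (x 0)) * ((w : ℤ) : ℂ)) fun z => ?_).2
    linear_combination hsum z

/-- The row in which the variable `x_i` occurs in the column `a` of an orthogonal design. -/
noncomputable def IsCOD.row (h : X.IsCOD) (i : Fin k) (a : Fin K) : Fin T :=
  (h.existsUnique_row i a).choose

theorem IsCOD.index_row (h : X.IsCOD) (i : Fin k) (a : Fin K) :
    (X (h.row i a) a).index = some i :=
  (h.existsUnique_row i a).choose_spec.1

theorem IsCOD.row_eq_iff (h : X.IsCOD) : h.row i a = t ↔ (X t a).index = some i :=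
  ⟨fun ht => ht ▸ h.index_row i a, fun ht => h.row_unique (h.index_row i a) ht⟩

theorem IsCOD.row_injective (h : X.IsCOD) (a : Fin K) : Function.Injective (h.row · a) := by
  intro i j hij
  have hi : (X (h.row j a) a).index = some i := h.row_eq_iff.1 hij
  rwa [h.index_row, Option.some.injEq, eq_comm] at hi

theorem IsCOD.row_injective_right (h : X.IsCOD) (i : Fin k) : Function.Injective (h.row i) :=
  fun a _ hab => h.col_unique (h.index_row i a) (h.row_eq_iff.1 hab.symm)

theorem IsCOD.variables_le_rows (h : X.IsCOD) (hK : 0 < K) : k ≤ T := by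
  simpa using Fintype.card_le_of_injective _ (h.row_injective ⟨0, hK⟩)

theorem IsCOD.columns_le_rows (h : X.IsCOD) (hk : 0 < k) : K ≤ T := by
  simpa using Fintype.card_le_of_injective _ (h.row_injective_right ⟨0, hk⟩)

theorem IsCOD.variables_lt_rows_of_eq_zero (h : X.IsCOD) (hX : X t a = .zero) : k < T := by
  have hnot_surj : ¬ Function.Surjective (h.row · a) := fun hsurj => by
    obtain ⟨i, hi⟩ := hsurj t
    simpa [hX, Entry.index] using h.row_eq_iff.1 hi
  simpa using Fintype.card_lt_of_injective_not_surjective _ (h.row_injective a) hnot_surj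

/-! ### Row weights and the bound on the rate -/

/-- The set of columns in which a row has a nonzero entry. -/
def rowSupport (X : Design T K k) (t : Fin T) : Finset (Fin K) :=
  {a | (X t a).index.isSome}

/-- The set of variables occurring in a row. -/
def rowVariables (X : Design T K k) (t : Fin T) : Finset (Fin k) :=
  {i | ∃ a, (X t a).index = some i}

theorem mem_rowSupport : a ∈ X.rowSupport t ↔ ∃ i, (X t a).index = some i := by
  simp [rowSupport, Option.isSome_iff_exists]

theorem mem_rowVariables : i ∈ X.rowVariables t ↔ ∃ a, (X t a).index = some i := by
  simp [rowVariables]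

theorem IsCOD.card_rowVariables (h : X.IsCOD) (t : Fin T) :
    #(X.rowVariables t) = #(X.rowSupport t) := by
  have himage : (X.rowSupport t).image (fun a => (X t a).index) =
      (X.rowVariables t).map .some := by
    ext o
    cases o with
    | none => simp +contextual [mem_rowSupport]
    | some i =>
      simp only [mem_image, mem_map, mem_rowSupport, mem_rowVariables,
        Function.Embedding.some_apply, Option.some.injEq, exists_eq_right]
      exact ⟨fun ⟨a, _, ha⟩ => ⟨a, ha⟩, fun ⟨a, ha⟩ => ⟨a, ⟨i, ha⟩, ha⟩⟩
  rw [← card_map .some, ← himage, card_image_of_injOn]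
  intro a ha b _ (hab : (X t a).index = (X t b).index)
  obtain ⟨i, hi⟩ := mem_rowSupport.1 ha
  exact h.col_unique hi (hab ▸ hi)

theorem IsCOD.sum_card_rowSupport_smul (h : X.IsCOD) {M : Type*} [AddCommMonoid M]
    (f : Fin T → M) : ∑ t, #(X.rowSupport t) • f t = ∑ i, ∑ a, f (h.row i a) := by
  have hcol (a : Fin K) :
      ∑ t, (if (X t a).index.isSome then f t else 0) = ∑ i, f (h.row i a) := by
    refine (Fintype.sum_of_injective _ (h.row_injective a) _ _ (fun t ht => if_neg fun hsome => ?_)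
      fun i => ?_).symm
    · obtain ⟨i, hi⟩ := Option.isSome_iff_exists.1 hsome
      exact ht ⟨i, h.row_eq_iff.2 hi⟩
    · simp [h.index_row]
  calc ∑ t, #(X.rowSupport t) • f t = ∑ t, ∑ a, if (X t a).index.isSome then f t else 0 := by
        simp only [← sum_filter, sum_const, rowSupport]
    _ = ∑ i, ∑ a, f (h.row i a) := by
        rw [sum_comm, sum_congr rfl fun a _ => hcol a, sum_comm]

theorem IsCOD.sum_card_rowSupport (h : X.IsCOD) : ∑ t, #(X.rowSupport t) = k * K := by
  simpa using h.sum_card_rowSupport_smul fun _ => (1 : ℕ)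

theorem IsCOD.card_rowSupport_le (h : X.IsCOD) (t : Fin T) : #(X.rowSupport t) ≤ k := by
  simpa [h.card_rowVariables] using card_le_univ (X.rowVariables t)

/-- Whether the variable `x_i` occurs conjugated in the column `a` of an orthogonal design. -/
noncomputable def IsCOD.conjugated (h : X.IsCOD) (i : Fin k) (a : Fin K) : Bool :=
  (X (h.row i a) a).isConj

theorem IsCOD.conjugated_ne_of_mem_rowSupport (h : X.IsCOD) (hab : a ≠ b)
    (hb : b ∈ X.rowSupport (h.row i a)) : h.conjugated i b ≠ h.conjugated i a := by
  intro hconj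
  obtain ⟨j, hj⟩ := mem_rowSupport.1 hb
  simpa [hj] using
    h.index_eq_none_of_isConj_eq hab (h.index_row i a) (h.index_row i b) hconj.symm

theorem IsCOD.card_rowSupport_row_le (h : X.IsCOD) (i : Fin k) (a : Fin K) :
    #(X.rowSupport (h.row i a)) ≤ #{b | h.conjugated i b ≠ h.conjugated i a} + 1 := by
  refine (card_le_card fun b hb => ?_).trans (card_insert_le a _)
  rw [mem_insert, mem_filter_univ, or_iff_not_imp_left]
  exact fun hba => h.conjugated_ne_of_mem_rowSupport (Ne.symm hba) hb

theorem IsCOD.sum_card_rowSupport_row_add_le (h : X.IsCOD) {m : ℕ}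
    (hK : K = 2 * m ∨ K + 1 = 2 * m) (i : Fin k) :
    ∑ a, #(X.rowSupport (h.row i a)) + 2 * m ^ 2 ≤ (2 * m + 1) * K := by
  set p := #{b | h.conjugated i b = true}
  set q := #{b | h.conjugated i b = false}
  have hpq : p + q = K := by
    simpa using card_filter_add_card_filter_not (s := univ) (h.conjugated i · = true)
  have hsum : ∑ a, #(X.rowSupport (h.row i a)) ≤ 2 * (p * q) + K := by
    rw [← sum_card_filter_ne]
    simpa [sum_add_distrib] using sum_le_sum fun a (_ : a ∈ univ) => h.card_rowSupport_row_le i a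
  have hmax : p * q + m ^ 2 ≤ m * (p + q) := mul_add_sq_le_mul_add (by rwa [hpq])
  rw [hpq] at hmax
  linarith

/-- Sum `(w - m) * (w - (m + 1)) ≥ 0` over the weights `w` of the rows. -/
theorem IsCOD.two_mul_mul_variables_le (h : X.IsCOD) {m : ℕ} (hm : 0 < m)
    (hK : K = 2 * m ∨ K + 1 = 2 * m) : 2 * m * k ≤ (m + 1) * T := by
  have hsq : ∑ t, #(X.rowSupport t) * #(X.rowSupport t) + k * (2 * m ^ 2) ≤
      k * ((2 * m + 1) * K) := by
    have hrow := sum_le_sum fun i (_ : i ∈ univ) => h.sum_card_rowSupport_row_add_le hK i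
    have hweight := h.sum_card_rowSupport_smul fun t => #(X.rowSupport t)
    simp only [smul_eq_mul] at hweight
    simpa [sum_add_distrib, ← hweight] using hrow
  have hconv : (2 * m + 1) * (k * K) ≤
      ∑ t, #(X.rowSupport t) * #(X.rowSupport t) + T * (m * (m + 1)) := by
    rw [← h.sum_card_rowSupport, mul_sum]
    simpa [sum_add_distrib] using
      sum_le_sum fun t (_ : t ∈ univ) => two_mul_add_one_mul_le #(X.rowSupport t) m
  refine le_of_mul_le_mul_left ?_ hm
  linarith

/-- A variable in position `(s, b)` also occurs in the row `r`. Its conjugation statuses in the two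
rows differ, so the two supports meet the columns in complementary classes. -/
theorem IsCOD.card_rowSupport_add_card_rowSupport_le (h : X.IsCOD) (hrs : r ≠ s)
    (hr : (X r a).index = some i) (hs : (X s b).index = some i) (hb : b ∈ X.rowSupport r) :
    #(X.rowSupport r) + #(X.rowSupport s) ≤ K + 2 := by
  obtain rfl := h.row_eq_iff.2 hr
  obtain rfl := h.row_eq_iff.2 hs
  have hab : a ≠ b := fun hab => hrs (hab ▸ rfl)
  have hconj := Bool.eq_not.2 (h.conjugated_ne_of_mem_rowSupport hab hb)
  have hsplit : #{c | h.conjugated i c = h.conjugated i a} +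
      #{c | h.conjugated i c ≠ h.conjugated i a} = K := by
    simpa using card_filter_add_card_filter_not (s := univ) (h.conjugated i · = h.conjugated i a)
  have hra := h.card_rowSupport_row_le i a
  have hsb := h.card_rowSupport_row_le i b
  simp only [hconj, Bool.ne_not] at hsb
  omega

theorem IsCOD.eq_of_card_rowSupport_eq (h : X.IsCOD) (hk : K + 2 < 2 * k)
    (hr : #(X.rowSupport r) = k) (hs : #(X.rowSupport s) = k) : r = s := by
  by_contra hrs
  obtain ⟨b, hb⟩ : (X.rowSupport r ∩ X.rowSupport s).Nonempty :=
    inter_nonempty_of_card_lt_card_add_card (subset_univ _) (subset_univ _)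
      (by rw [hr, hs, card_univ, Fintype.card_fin]; omega)
  obtain ⟨hbr, hbs⟩ := mem_inter.1 hb
  obtain ⟨i, hi⟩ := mem_rowSupport.1 hbs
  have hvars : X.rowVariables r = univ := by
    rw [← card_eq_iff_eq_univ, h.card_rowVariables, hr, Fintype.card_fin]
  obtain ⟨a, ha⟩ := mem_rowVariables.1 (hvars ▸ mem_univ i)
  have := h.card_rowSupport_add_card_rowSupport_le hrs ha hi hbr
  omega

theorem IsCOD.mul_columns_add_rows_le (h : X.IsCOD) (hk : K + 2 < 2 * k) :
    k * K + T ≤ T * k + 1 := by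
  have hfull : #{t | #(X.rowSupport t) = k} ≤ 1 :=
    card_le_one.2 fun r hr s hs =>
      h.eq_of_card_rowSupport_eq hk (by simpa using hr) (by simpa using hs)
  calc k * K + T = ∑ t, (#(X.rowSupport t) + 1) := by
        simp [sum_add_distrib, h.sum_card_rowSupport]
    _ ≤ ∑ t, (k + if #(X.rowSupport t) = k then 1 else 0) := by
        refine sum_le_sum fun t _ => ?_
        have := h.card_rowSupport_le t
        split_ifs <;> omega
    _ = T * k + #{t | #(X.rowSupport t) = k} := by simp [sum_add_distrib]
    _ ≤ T * k + 1 := by gcongr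

theorem not_isCOD_of_eight_rows_five_variables (X : Design 8 K 5) (hK : 7 ≤ K) : ¬ X.IsCOD :=
  fun h => by
    simpa using (h.submatrix (Fin.castLE_injective hK)).mul_columns_add_rows_le (by norm_num)

end Design

/-! ### Orthogonal designs from the subsets of a finite set -/

section SymmDiff

variable {ι : Type*} [DecidableEq ι] {S : Finset ι} {i j : ι}

theorem prod_symmDiff_of_mul_self_eq_one {M : Type*} [CommMonoid M] {f : ι → M}
    (hf : ∀ i, f i * f i = 1) (s t : Finset ι) :
    ∏ i ∈ symmDiff s t, f i = (∏ i ∈ s, f i) * ∏ i ∈ t, f i := by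
  have hinter : (∏ i ∈ s ∩ t, f i) * ∏ i ∈ t ∩ s, f i = 1 := by
    rw [inter_comm t, ← prod_mul_distrib, prod_eq_one fun i _ => hf i]
  rw [show symmDiff s t = s \ t ∪ t \ s from rfl, prod_union disjoint_sdiff_sdiff,
    ← prod_inter_mul_prod_sdiff s t, ← prod_inter_mul_prod_sdiff t s, mul_mul_mul_comm, hinter,
    one_mul]

theorem card_symmDiff_singleton_add_one (h : j ∈ S) : #(symmDiff S {j}) + 1 = #S := by
  rw [symmDiff_of_ge (singleton_subset_iff.2 h), sdiff_singleton_eq_erase, card_erase_add_one h]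

theorem card_symmDiff_singleton (h : j ∉ S) : #(symmDiff S {j}) = #S + 1 := by
  rw [(disjoint_singleton_right.2 h).symmDiff_eq_sup, sup_eq_union, union_singleton,
    card_insert_of_notMem h]

theorem symmDiff_pair_symmDiff_left (hij : i ≠ j) (S : Finset ι) :
    symmDiff (symmDiff S {i, j}) {i} = symmDiff S {j} := by
  have hpair : symmDiff {i, j} {i} = ({j} : Finset ι) := by
    ext l
    grind [mem_symmDiff]
  rw [symmDiff_assoc, hpair]

end SymmDiff

section SubsetMatrix

variable {ι : Type*} [LinearOrder ι] {S : Finset ι} {i j : ι}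

/-- The Jordan–Wigner sign `(-1)^#{i ∈ S | i < j}`. -/
def subsetSign (S : Finset ι) (j : ι) : ℤˣ :=
  ∏ i ∈ S, if i < j then -1 else 1

theorem subsetSign_symmDiff (S R : Finset ι) (j : ι) :
    subsetSign (symmDiff S R) j = subsetSign S j * subsetSign R j :=
  prod_symmDiff_of_mul_self_eq_one (fun _ => Int.units_mul_self _) S R

theorem subsetSign_pair_mul (hij : i ≠ j) :
    subsetSign {i, j} i * subsetSign {i, j} j = -1 := by
  rcases hij.lt_or_gt with h | h <;> simp [subsetSign, hij, h, h.not_gt]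

/-- The matrix with the entries `± y (S ∆ {j})`, conjugated if `j ∈ S`: its columns describe the
operators that create and annihilate the elements of `ι`. -/
noncomputable def subsetMatrix (y : Finset ι → ℂ) : Matrix (Finset ι) ι ℂ := fun S j =>
  ((subsetSign S j : ℤ) : ℂ) *
    if j ∈ S then star (y (symmDiff S {j})) else y (symmDiff S {j})

theorem norm_subsetMatrix_apply (y : Finset ι → ℂ) (S : Finset ι) (j : ι) :
    ‖subsetMatrix y S j‖ = ‖y (symmDiff S {j})‖ := by
  rcases Int.units_eq_one_or (subsetSign S j) with h | h <;> rw [subsetMatrix, h] <;>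
    split_ifs <;> simp

theorem subsetMatrix_apply_eq_zero {y : Finset ι → ℂ} {q : ℕ} (hy : ∀ U, #U ≠ q + 1 → y U = 0)
    (hS : ¬ (#S = q ∨ #S = q + 2)) (j : ι) : subsetMatrix y S j = 0 := by
  rw [← norm_eq_zero, norm_subsetMatrix_apply, norm_eq_zero]
  refine hy _ fun hU => hS ?_
  by_cases hj : j ∈ S
  · have := card_symmDiff_singleton_add_one hj
    omega
  · have := card_symmDiff_singleton hj
    omega

/-- Passing from `S` to `S ∆ {i, j}` interchanges the two values of `y` and flips the sign. If only
one of `i` and `j` lies in `S`, then `S ∆ {i}` and `S ∆ {j}` have different cardinalities, so that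
both terms vanish. -/
theorem star_subsetMatrix_mul_symmDiff_pair {y : Finset ι → ℂ} {p : ℕ}
    (hy : ∀ U, #U ≠ p → y U = 0) (hij : i ≠ j) (S : Finset ι) :
    star (subsetMatrix y S i) * subsetMatrix y S j +
      star (subsetMatrix y (symmDiff S {i, j}) i) * subsetMatrix y (symmDiff S {i, j}) j = 0 := by
  have hleft := symmDiff_pair_symmDiff_left hij S
  have hright := symmDiff_pair_symmDiff_left hij.symm S
  rw [pair_comm] at hright
  have hmem_left : i ∈ symmDiff S {i, j} ↔ i ∉ S := by simp [mem_symmDiff]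
  have hmem_right : j ∈ symmDiff S {i, j} ↔ j ∉ S := by simp [mem_symmDiff]
  have hsign : ((subsetSign {i, j} i : ℤ) : ℂ) * ((subsetSign {i, j} j : ℤ) : ℂ) = -1 := by
    simpa using congrArg (fun u : ℤˣ => ((u : ℤ) : ℂ)) (subsetSign_pair_mul hij)
  have hcard (h : y (symmDiff S {i}) ≠ 0) (h' : y (symmDiff S {j}) ≠ 0) : i ∈ S ↔ j ∈ S := by
    have hi := not_imp_comm.1 (hy _) h
    have hj := not_imp_comm.1 (hy _) h'
    grind [card_symmDiff_singleton, card_symmDiff_singleton_add_one]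
  simp only [subsetMatrix, hleft, hright, hmem_left, hmem_right, subsetSign_symmDiff, star_mul',
    star_intCast, Units.val_mul, Int.cast_mul]
  by_cases hi : y (symmDiff S {i}) = 0
  · simp [hi]
  by_cases hj : y (symmDiff S {j}) = 0
  · simp [hj]
  by_cases hmem : i ∈ S
  · simp only [hmem, (hcard hi hj).1 hmem, if_true, not_true, if_false, star_star]
    linear_combination (((subsetSign S i : ℤ) : ℂ) * ((subsetSign S j : ℤ) : ℂ) *
      y (symmDiff S {i}) * star (y (symmDiff S {j}))) * hsign
  · simp only [hmem, mt (hcard hi hj).2 hmem, if_true, not_false_iff, if_false, star_star]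
    linear_combination (((subsetSign S i : ℤ) : ℂ) * ((subsetSign S j : ℤ) : ℂ) *
      star (y (symmDiff S {i})) * y (symmDiff S {j})) * hsign

theorem subsetMatrix_conjTranspose_mul_self [Fintype ι] {y : Finset ι → ℂ} {p : ℕ}
    (hy : ∀ U, #U ≠ p → y U = 0) :
    (subsetMatrix y)ᴴ * subsetMatrix y = ((∑ U, ‖y U‖ ^ 2 : ℝ) : ℂ) • 1 := by
  ext i j
  rw [Matrix.smul_apply, Matrix.one_apply, Matrix.mul_apply]
  simp only [Matrix.conjTranspose_apply]
  split_ifs with hij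
  · subst hij
    rw [smul_eq_mul, mul_one, Complex.ofReal_sum]
    refine Fintype.sum_bijective (symmDiff · {i})
      (symmDiff_left_involutive {i}).bijective _ _ fun S => ?_
    rw [← norm_subsetMatrix_apply, Complex.ofReal_pow]
    exact Complex.conj_mul' _
  · rw [smul_zero]
    refine sum_involution (fun S _ => symmDiff S {i, j})
      (fun S _ => star_subsetMatrix_mul_symmDiff_pair hy hij S) (fun S _ _ hS => ?_)
      (fun _ _ => mem_univ _) (fun S _ => symmDiff_symmDiff_cancel_right _ S)
    have : ({i, j} : Finset ι) = ∅ := symmDiff_eq_left.1 hS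
    exact insert_ne_empty _ _ this

end SubsetMatrix

theorem conjTranspose_mul_self_submatrix {m m' n R : Type*} [Fintype m] [Fintype m']
    [NonUnitalNonAssocSemiring R] [StarRing R] {A : Matrix m n R} {g : m' → m}
    (hg : Function.Injective g) (hA : ∀ i ∉ Set.range g, ∀ a, A i a = 0) :
    (A.submatrix g id)ᴴ * A.submatrix g id = Aᴴ * A := by
  ext a b
  exact Fintype.sum_of_injective g hg _ _ (fun i hi => by simp [hA i hi]) fun _ => rfl

theorem card_subtype_card_eq_or_eq {ι : Type*} [Fintype ι] {p q : ℕ} (hpq : p ≠ q) :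
    Fintype.card {S : Finset ι // #S = p ∨ #S = q} =
      (Fintype.card ι).choose p + (Fintype.card ι).choose q := by
  rw [Fintype.card_subtype_or_disjoint, Fintype.card_finset_len, Fintype.card_finset_len]
  exact Set.disjoint_left.2 fun _ hp hq => hpq (hp.symm.trans hq)

section SubsetDesign

variable {ι : Type*} [LinearOrder ι] {p k : ℕ}

/-- The formal version of the entries of `subsetMatrix`, where the variables are indexed by the
sets of cardinality `p` through the enumeration `e`. -/
def subsetEntry (e : {U : Finset ι // #U = p} ≃ Fin k) (S : Finset ι) (j : ι) : Entry k :=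
  if h : #(symmDiff S {j}) = p then
    if j ∈ S then .conjVar (subsetSign S j) (e ⟨_, h⟩) else .var (subsetSign S j) (e ⟨_, h⟩)
  else .zero

theorem eval_subsetEntry (e : {U : Finset ι // #U = p} ≃ Fin k) (x : Fin k → ℂ)
    (S : Finset ι) (j : ι) : (subsetEntry e S j).eval 0 x =
      subsetMatrix (fun U => if h : #U = p then x (e ⟨U, h⟩) else 0) S j := by
  by_cases h : #(symmDiff S {j}) = p
  · simp only [subsetEntry, subsetMatrix, dif_pos h]
    split_ifs <;> rfl
  · simp [subsetEntry, subsetMatrix, h, Entry.eval]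

end SubsetDesign

theorem exists_isCOD_choose (n q : ℕ) :
    ∃ X : Design (n.choose q + n.choose (q + 2)) n (n.choose (q + 1)), X.IsCOD := by
  let e : {U : Finset (Fin n) // #U = q + 1} ≃ Fin (n.choose (q + 1)) :=
    Fintype.equivFinOfCardEq (by simp)
  let f : {S : Finset (Fin n) // #S = q ∨ #S = q + 2} ≃ Fin (n.choose q + n.choose (q + 2)) :=
    Fintype.equivFinOfCardEq (by simp [card_subtype_card_eq_or_eq])
  refine ⟨fun t j => subsetEntry e (f.symm t).1 j, fun x => ?_⟩
  let y (U : Finset (Fin n)) : ℂ := if h : #U = q + 1 then x (e ⟨U, h⟩) else 0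
  have hy (U) (hU : #U ≠ q + 1) : y U = 0 := dif_neg hU
  have heval : Design.eval (fun t j => subsetEntry e (f.symm t).1 j) x =
      (subsetMatrix y).submatrix (Subtype.val ∘ f.symm) id := by
    ext t j
    exact eval_subsetEntry e x (f.symm t).1 j
  have hnorm : ∑ i, ‖x i‖ ^ 2 = ∑ U, ‖y U‖ ^ 2 := by
    refine Fintype.sum_of_injective (fun i => (e.symm i).1)
      (Subtype.val_injective.comp e.symm.injective) _ _ (fun U hU => ?_) fun i => ?_
    · rw [hy U fun hU' => hU ⟨e ⟨U, hU'⟩, by simp⟩, norm_zero, zero_pow two_ne_zero]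
    · simp [y, (e.symm i).2]
  rw [heval, conjTranspose_mul_self_submatrix (Subtype.val_injective.comp f.symm.injective),
    subsetMatrix_conjTranspose_mul_self hy, hnorm]
  exact fun S hS => subsetMatrix_apply_eq_zero hy fun hS' => hS ⟨f ⟨S, hS'⟩, by simp⟩

/-- A `4 × 4` design of rate `3/4`, half as long as the design on the subsets of a four-element
set. -/
def rateThreeQuartersDesign : Design 4 4 3 :=
  !![.var 1 0, .var 1 1, .var 1 2, .zero;
    .conjVar (-1) 1, .conjVar 1 0, .zero, .var 1 2;
    .conjVar (-1) 2, .zero, .conjVar 1 0, .var (-1) 1;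
    .zero, .conjVar (-1) 2, .conjVar 1 1, .var 1 0]

theorem rateThreeQuartersDesign_isCOD : rateThreeQuartersDesign.IsCOD := by
  refine Design.isCOD_iff_sum.2 fun x a b => ?_
  have hnorm (z : ℂ) : (‖z‖ : ℂ) ^ 2 = (starRingEnd ℂ) z * z := (Complex.conj_mul' z).symm
  fin_cases a <;> fin_cases b <;>
    simp [rateThreeQuartersDesign, Fin.sum_univ_four, Fin.sum_univ_three, Entry.eval, hnorm] <;>
    ring

/-! ### The maximal rate -/

theorem two_mul_mul_choose_succ {n q : ℕ} (hn : n = 2 * (q + 1) ∨ n + 1 = 2 * (q + 1)) :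
    2 * (q + 1) * n.choose (q + 1) = (q + 2) * (n.choose q + n.choose (q + 2)) := by
  have hlower := Nat.choose_succ_right_eq n q
  have hupper : n.choose (q + 2) * (q + 2) = n.choose (q + 1) * (n - (q + 1)) :=
    Nat.choose_succ_right_eq n (q + 1)
  rcases hn with rfl | hn
  · rw [show 2 * (q + 1) - (q + 1) = q + 1 by omega] at hupper
    rw [show 2 * (q + 1) - q = q + 2 by omega] at hlower
    linarith
  · rw [show n - (q + 1) = q by omega] at hupper
    rw [show n - q = q + 1 by omega] at hlower
    have hcentral := Nat.eq_of_mul_eq_mul_right (Nat.succ_pos q) hlower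
    rw [← hcentral]
    linarith

theorem choose_rate_eq {n q : ℕ} (hn : n = 2 * (q + 1) ∨ n + 1 = 2 * (q + 1)) :
    (n.choose (q + 1) : ℚ) / (n.choose q + n.choose (q + 2) : ℕ) =
      ((q + 1 : ℕ) + 1) / (2 * (q + 1 : ℕ)) := by
  have hpos : 0 < n.choose q + n.choose (q + 2) := Nat.add_pos_left (Nat.choose_pos (by omega)) _
  rw [div_eq_div_iff (by exact_mod_cast hpos.ne') (by positivity), mul_comm]
  exact_mod_cast two_mul_mul_choose_succ hn

theorem exists_isCOD_rate_eq {m K : ℕ} (hm : 0 < m) (hK : K = 2 * m ∨ K + 1 = 2 * m) :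
    ∃ (T k : ℕ) (X : Design T K k), X.IsCOD ∧ (k : ℚ) / T = (m + 1) / (2 * m) := by
  obtain ⟨q, rfl⟩ := Nat.exists_eq_add_of_le' hm
  obtain ⟨X, hX⟩ := exists_isCOD_choose K q
  exact ⟨_, _, X, hX, choose_rate_eq hK⟩

namespace Design

variable {T K k m : ℕ} {X : Design T K k}

theorem IsCOD.rate_le (h : X.IsCOD) (hm : 0 < m) (hK : K = 2 * m ∨ K + 1 = 2 * m) :
    (k : ℚ) / T ≤ (m + 1) / (2 * m) := by
  rcases Nat.eq_zero_or_pos T with rfl | hT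
  · rw [Nat.cast_zero, div_zero]
    positivity
  rw [div_le_div_iff₀ (by exact_mod_cast hT) (by positivity), mul_comm (k : ℚ)]
  exact_mod_cast h.two_mul_mul_variables_le hm hK

theorem isMaximalRateCOD_iff (hm : 0 < m) (hK : K = 2 * m ∨ K + 1 = 2 * m) :
    X.IsMaximalRateCOD ↔ X.IsCOD ∧ (k : ℚ) / T = (m + 1) / (2 * m) := by
  refine ⟨fun h => ⟨h.1, (h.1.rate_le hm hK).antisymm ?_⟩,
    fun h => ⟨h.1, fun _ _ _ hY => (hY.rate_le hm hK).trans_eq h.2.symm⟩⟩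
  obtain ⟨T', k', Y, hY, hrate⟩ := exists_isCOD_rate_eq hm hK
  exact hrate ▸ h.2 T' k' Y hY

theorem exists_isMaximalRateCOD (hK : 0 < K) :
    ∃ (T k : ℕ) (X : Design T K k), X.IsMaximalRateCOD := by
  have hm : 0 < (K + 1) / 2 := by omega
  have hKm : K = 2 * ((K + 1) / 2) ∨ K + 1 = 2 * ((K + 1) / 2) := by omega
  obtain ⟨T, k, X, hX⟩ := exists_isCOD_rate_eq hm hKm
  exact ⟨T, k, X, (isMaximalRateCOD_iff hm hKm).2 hX⟩

theorem IsMaximalRateCOD.rate_pos (h : X.IsMaximalRateCOD) (hK : 0 < K) : (0 : ℚ) < k / T := by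
  have hm : 0 < (K + 1) / 2 := by omega
  rw [((isMaximalRateCOD_iff hm (by omega)).1 h).2]
  positivity

theorem IsMaximalRateCOD.rows_pos (h : X.IsMaximalRateCOD) (hK : 0 < K) : 0 < T :=
  Nat.pos_of_ne_zero fun hT => (h.rate_pos hK).ne' (by rw [hT, Nat.cast_zero, div_zero])

theorem IsMaximalRateCOD.variables_pos (h : X.IsMaximalRateCOD) (hK : 0 < K) : 0 < k :=
  Nat.pos_of_ne_zero fun hk => (h.rate_pos hK).ne' (by rw [hk, Nat.cast_zero, zero_div])

theorem IsMaximalRateCOD.two_mul_mul_variables_eq (h : X.IsMaximalRateCOD) (hm : 0 < m)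
    (hK : K = 2 * m ∨ K + 1 = 2 * m) : 2 * m * k = (m + 1) * T := by
  have hT := h.rows_pos (by omega)
  have hrate := ((isMaximalRateCOD_iff hm hK).1 h).2
  rw [div_eq_div_iff (by positivity) (by positivity), mul_comm (k : ℚ)] at hrate
  exact_mod_cast hrate

end Design

/-! ### Rates and generation of training-embedded codes -/

theorem firstPhaseUses_eq {T k : ℕ} (h : k ≤ T) : firstPhaseUses T k = (T - k + 1) / 2 + k := by
  rw [firstPhaseUses, Nat.add_right_cancel_iff, ← Nat.cast_sub h]
  refine eq_of_forall_ge_iff fun c => ?_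
  rw [Nat.ceil_le, div_le_iff₀ two_pos]
  norm_cast
  omega

namespace TEDSTBC

variable {T K k : ℕ}

theorem overallRate_eq (C : TEDSTBC T K k) :
    C.overallRate = (k : ℚ) / ((⌈((T : ℚ) - k) / 2⌉ : ℤ) + (k : ℚ) + T) := by
  have hnonneg : (0 : ℚ) ≤ ((T : ℚ) - k) / 2 :=
    div_nonneg (sub_nonneg.2 (by exact_mod_cast C.k_le)) two_pos.le
  rw [overallRate, channelUses, firstPhaseUses, Fintype.card_fin, Fintype.card_fin,
    ← natCast_ceil_eq_intCast_ceil hnonneg, Nat.cast_add, Nat.cast_add]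

theorem overallRate_eq_nat (C : TEDSTBC T K k) :
    C.overallRate = (k : ℚ) / (((T - k + 1) / 2 + k + T : ℕ) : ℚ) := by
  rw [overallRate, channelUses, Fintype.card_fin, Fintype.card_fin, firstPhaseUses_eq C.k_le]

theorem exists_extendedVector_apply_eq_symbol (C : TEDSTBC T K k) (i : Fin k) :
    ∃ t, ∀ x, C.extendedVector x t = x i :=
  ⟨(Fin.natAdd (T - k) i).cast (Nat.sub_add_cancel C.k_le), fun x => by simp [extendedVector]⟩

theorem exists_extendedVector_apply_eq_alpha (C : TEDSTBC T K k) (h : k < T) :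
    ∃ t, ∀ x, C.extendedVector x t = C.alpha :=
  ⟨(Fin.castAdd k ⟨0, Nat.sub_pos_of_lt h⟩).cast (Nat.sub_add_cancel C.k_le),
    fun x => Fin.append_left (fun _ : Fin (T - k) => C.alpha) x ⟨0, Nat.sub_pos_of_lt h⟩⟩

theorem exists_dotProduct_extendedVector_eq_eval (C : TEDSTBC T K k) (e : Entry k)
    (he : e = .zero → k < T) : ∃ a b : Fin T → ℂ, ∀ x,
      a ⬝ᵥ C.extendedVector x + b ⬝ᵥ star (C.extendedVector x) = e.eval C.alpha x := by
  cases e with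
  | zero =>
    obtain ⟨t, ht⟩ := C.exists_extendedVector_apply_eq_alpha (he rfl)
    exact ⟨Pi.single t 1, 0, fun x => by simp [ht, Entry.eval]⟩
  | var s i =>
    obtain ⟨t, ht⟩ := C.exists_extendedVector_apply_eq_symbol i
    exact ⟨Pi.single t ((s : ℤ) : ℂ), 0, fun x => by simp [ht, Entry.eval]⟩
  | conjVar s i =>
    obtain ⟨t, ht⟩ := C.exists_extendedVector_apply_eq_symbol i
    exact ⟨0, Pi.single t ((s : ℤ) : ℂ), fun x => by simp [ht, Entry.eval]⟩

theorem exists_isGeneratedBy {X : Design T K k} (hkT : k ≤ T)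
    (hX : ∀ t l, X t l = .zero → k < T) {α : ℂ} (hα : α ≠ 0) (M : Set ℂ) :
    ∃ C : TEDSTBC T K k, C.alpha = α ∧ C.signalSet = M ∧ C.IsGeneratedBy X := by
  let C : TEDSTBC T K k := ⟨hkT, α, hα, M, 0, 0⟩
  choose a b hab using fun t l => C.exists_dotProduct_extendedVector_eq_eval (X t l) (hX t l)
  refine ⟨{ C with A := fun l t => a t l, B := fun l t => b t l }, rfl, rfl, fun x => ?_⟩
  ext t l
  exact hab t l x

end TEDSTBC

theorem Design.IsCOD.exists_isGeneratedBy {T K k : ℕ} {X : Design T K k} (hX : X.IsCOD)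
    (hK : 0 < K) {α : ℂ} (hα : α ≠ 0) (M : Set ℂ) :
    ∃ C : TEDSTBC T K k, C.alpha = α ∧ C.signalSet = M ∧ C.IsGeneratedBy X :=
  TEDSTBC.exists_isGeneratedBy (hX.variables_le_rows hK)
    (fun _ _ hzero => hX.variables_lt_rows_of_eq_zero hzero) hα M

/-! ### The overall rates of maximal-rate designs -/

namespace Design.IsMaximalRateCOD

variable {T K k m : ℕ} {X : Design T K k}

theorem overallRate_eq (hX : X.IsMaximalRateCOD) (hm : 0 < m)
    (hK : K = 2 * m ∨ K + 1 = 2 * m) (C : TEDSTBC T K k) :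
    C.overallRate = ((T : ℚ) * (m + 1) / (2 * m)) /
      ((T : ℚ) * (m + 1) / (2 * m) + T + (⌈(T : ℚ) * (1 / 4 - 1 / (4 * m))⌉ : ℤ)) := by
  have hk : (T : ℚ) * (m + 1) / (2 * m) = k := by
    rw [div_eq_iff (by positivity), mul_comm (T : ℚ), mul_comm (k : ℚ)]
    exact_mod_cast (hX.two_mul_mul_variables_eq hm hK).symm
  have hpadding : (T : ℚ) * (1 / 4 - 1 / (4 * m)) = (T - k) / 2 := by
    rw [← hk]
    field_simp
    ring
  rw [C.overallRate_eq, hk, hpadding]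
  congr 1
  ring

theorem one_third_lt_overallRate (hX : X.IsMaximalRateCOD) (hK : 0 < K) (hK9 : K < 9)
    (C : TEDSTBC T K k) : 1 / 3 < C.overallRate := by
  obtain ⟨m, hm, hm4, hKm⟩ : ∃ m, 0 < m ∧ m ≤ 4 ∧ (K = 2 * m ∨ K + 1 = 2 * m) :=
    ⟨(K + 1) / 2, by omega⟩
  have hT := hX.rows_pos hK
  have hk := hX.two_mul_mul_variables_eq hm hKm
  have hKT := hX.1.columns_le_rows (hX.variables_pos hK)
  -- `T = 8`, `k = 5` passes the other constraints and would give the rate `5 / 15`.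
  have hsmall : ¬ (T = 8 ∧ k = 5 ∧ 7 ≤ K) := by
    rintro ⟨rfl, rfl, hK7⟩
    exact not_isCOD_of_eight_rows_five_variables X hK7 hX.1
  rw [C.overallRate_eq_nat, div_lt_div_iff₀ (by norm_num) (by positivity)]
  norm_cast
  interval_cases m <;> omega

theorem overallRate_eq_one_third (hX : X.IsMaximalRateCOD) (hK : K = 9 ∨ K = 10)
    (C : TEDSTBC T K k) : C.overallRate = 1 / 3 := by
  have hT := hX.rows_pos (by omega)
  have hk := hX.two_mul_mul_variables_eq (m := 5) (by norm_num) (by omega)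
  rw [C.overallRate_eq_nat, div_eq_div_iff (by positivity) (by norm_num)]
  norm_cast
  omega

theorem overallRate_lt_one_third (hX : X.IsMaximalRateCOD) (hK : 11 ≤ K) (C : TEDSTBC T K k) :
    C.overallRate < 1 / 3 := by
  obtain ⟨m, hm6, hKm⟩ : ∃ m, 6 ≤ m ∧ (K = 2 * m ∨ K + 1 = 2 * m) := ⟨(K + 1) / 2, by omega⟩
  have hT := hX.rows_pos (by omega)
  have hk := hX.two_mul_mul_variables_eq (by omega) hKm
  have hrate : 5 * k < 3 * T := by
    refine lt_of_mul_lt_mul_left (a := 2 * m) ?_ (Nat.zero_le _)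
    nlinarith
  rw [C.overallRate_eq_nat, div_lt_div_iff₀ (by positivity) (by norm_num)]
  norm_cast
  omega

theorem overallRate_trichotomy (hX : X.IsMaximalRateCOD) (hK : 0 < K) (C : TEDSTBC T K k) :
    (1 / 3 < C.overallRate ↔ K < 9) ∧ (C.overallRate = 1 / 3 ↔ K = 9 ∨ K = 10) ∧
      (C.overallRate < 1 / 3 ↔ 11 ≤ K) := by
  have hlt := fun h => hX.one_third_lt_overallRate hK h C
  have heq := fun h => hX.overallRate_eq_one_third h C
  have hgt := fun h => hX.overallRate_lt_one_third h C
  grind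

end Design.IsMaximalRateCOD

theorem tableEntry_of_isCOD {m T K k : ℕ} {r : ℚ} (hm : 0 < m) (hK : K = 2 * m ∨ K + 1 = 2 * m)
    (hX : ∃ X : Design T K k, X.IsCOD) (hk : (k : ℚ) / T = (m + 1) / (2 * m))
    (hr : (k : ℚ) / (((T - k + 1) / 2 + k + T : ℕ) : ℚ) = r) : TableEntry K T k r :=
  ⟨hX.imp fun _ h => (Design.isMaximalRateCOD_iff hm hK).2 ⟨h, hk⟩,
    fun _ C _ _ => C.overallRate_eq_nat.trans hr⟩

theorem tableEntry_choose {q T K k : ℕ} {r : ℚ} (hK : K = 2 * (q + 1) ∨ K + 1 = 2 * (q + 1))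
    (hT : K.choose q + K.choose (q + 2) = T) (hk : K.choose (q + 1) = k)
    (hr : (k : ℚ) / (((T - k + 1) / 2 + k + T : ℕ) : ℚ) = r) : TableEntry K T k r := by
  subst hT hk
  exact tableEntry_of_isCOD q.succ_pos hK (exists_isCOD_choose K q) (choose_rate_eq hK) hr

theorem tableEntries :
    TableEntry 4 4 3 (3 / 8) ∧ TableEntry 5 15 10 (5 / 14) ∧ TableEntry 6 30 20 (4 / 11) ∧
      TableEntry 7 56 35 (35 / 102) ∧ TableEntry 8 112 70 (70 / 203) ∧
      TableEntry 9 210 126 (126 / 378) ∧ TableEntry 10 420 252 (252 / 756) :=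
  ⟨tableEntry_of_isCOD (m := 2) two_pos (by norm_num)
      ⟨_, rateThreeQuartersDesign_isCOD⟩ (by norm_num) (by norm_num),
    tableEntry_choose (q := 2) (by norm_num) (by decide) (by decide) (by norm_num),
    tableEntry_choose (q := 2) (by norm_num) (by decide) (by decide) (by norm_num),
    tableEntry_choose (q := 3) (by norm_num) (by decide) (by decide) (by norm_num),
    tableEntry_choose (q := 3) (by norm_num) (by decide) (by decide) (by norm_num),
    tableEntry_choose (q := 4) (by norm_num) (by decide) (by decide) (by norm_num),
    tableEntry_choose (q := 4) (by norm_num) (by decide) (by decide) (by norm_num)⟩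

theorem overallRateWithoutTraining_eq_one_third {T k : ℕ} (h : (k : ℚ) / T = 1 / 2) :
    overallRateWithoutTraining T k = 1 / 3 := by
  have hT : (T : ℚ) ≠ 0 := fun hT => by norm_num [hT] at h
  have hk : (k : ℚ) = T / 2 := by rw [(div_eq_iff hT).1 h, one_div_mul_eq_div]
  rw [overallRateWithoutTraining, hk]
  field_simp
  norm_num

end TECOD

theorem mainTheorem4 :
    -- the overall rate of an arbitrary TE-DSTBC
    (∀ (T K k : ℕ) (C : TECOD.TEDSTBC T K k),
      C.overallRate = (k : ℚ) / ((⌈((T : ℚ) - k) / 2⌉ : ℤ) + (k : ℚ) + T)) ∧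
    -- every COD generates a TE-DSTBC, for every training symbol and signal set
    (∀ (T K k : ℕ) (X : TECOD.Design T K k) (α : ℂ) (M : Set ℂ), 1 ≤ K → X.IsCOD → α ≠ 0 →
      ∃ C : TECOD.TEDSTBC T K k, C.alpha = α ∧ C.signalSet = M ∧ C.IsGeneratedBy X) ∧
    -- maximal-rate CODs exist for every number of relays
    (∀ K : ℕ, 1 ≤ K → ∃ (T k : ℕ) (X : TECOD.Design T K k), X.IsMaximalRateCOD) ∧
    -- the closed form for maximal-rate CODs and `2m` or `2m - 1` relays
    (∀ (m T K k : ℕ) (X : TECOD.Design T K k) (C : TECOD.TEDSTBC T K k),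
      1 ≤ m → (K = 2 * m ∨ K = 2 * m - 1) → X.IsMaximalRateCOD → C.IsGeneratedBy X →
      C.overallRate = ((T : ℚ) * (m + 1) / (2 * m)) /
        ((T : ℚ) * (m + 1) / (2 * m) + T + (⌈(T : ℚ) * (1 / 4 - 1 / (4 * m))⌉ : ℤ))) ∧
    -- the table of rates
    (TECOD.TableEntry 4 4 3 (3 / 8) ∧
      TECOD.TableEntry 5 15 10 (5 / 14) ∧
      TECOD.TableEntry 6 30 20 (4 / 11) ∧
      TECOD.TableEntry 7 56 35 (35 / 102) ∧
      TECOD.TableEntry 8 112 70 (70 / 203) ∧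
      TECOD.TableEntry 9 210 126 (126 / 378) ∧
      TECOD.TableEntry 10 420 252 (252 / 756)) ∧
    -- the overall rate of the earlier codes, of rate `1/2` in the second phase
    (∀ T k : ℕ, (k : ℚ) / T = 1 / 2 → TECOD.overallRateWithoutTraining T k = 1 / 3) ∧
    -- the comparison of the rates for maximal-rate CODs with `1/3`
    (∀ (T K k : ℕ) (X : TECOD.Design T K k) (C : TECOD.TEDSTBC T K k),
      1 ≤ K → X.IsMaximalRateCOD → C.IsGeneratedBy X →
      (1 / 3 < C.overallRate ↔ K < 9) ∧
      (C.overallRate = 1 / 3 ↔ K = 9 ∨ K = 10) ∧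
      (C.overallRate < 1 / 3 ↔ 11 ≤ K)) :=
  ⟨fun _ _ _ C => C.overallRate_eq,
    fun _ _ _ _ _ M hK hX hα => hX.exists_isGeneratedBy hK hα M,
    fun _ hK => TECOD.Design.exists_isMaximalRateCOD hK,
    fun _ _ _ _ _ C hm hK hX _ => hX.overallRate_eq hm (by omega) C,
    TECOD.tableEntries,
    fun _ _ => TECOD.overallRateWithoutTraining_eq_one_third,
    fun _ _ _ _ C hK hX _ => hX.overallRate_trichotomy hK C⟩
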